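/- Let $\mathbb{M}^2$ be a normed plane, i.e. a two-dimensional real normed space, and write $B(x,1)$ and $S(x,1)$ for the closed ball and the sphere with center $x$ and radius $1$. Let $K=\{p_1,\dots,p_n\}\subset\mathbb{M}^2$ be a finite set of diameter $1$, and let $$\operatorname{bh}(K)=\bigcap_{x:\,K\subseteq B(x,1)}B(x,1)$$ be its ball hull. For distinct points $p,q\in S(x,1)$, a circular arc of $S(x,1)$ meeting $p$ and $q$ is a simple arc contained in $S(x,1)$ with endpoints $p$ and $q$. It is called minimal if it lies in the closed half-plane bounded by the line through $p$ and $q$ that does not contain the center $x$ (if $p$ and $q$ are opposite points of $S(x,1)$, so that $x$ is on this line, both half-circles with endpoints $p$ and $q$ are minimal). Let $\mathcal{H}$ be the set of all balls of radius $1$ whose boundary contains a circular arc meeting two distinct points of $K$. Then $$\operatorname{bh}(K)=\bigcap_{\substack{K\subseteq B(x,1)\\ B(x,1)\in\mathcal{H}}}B(x,1)=\operatorname{conv}\Bigl(\bigcup \widehat{p_ip_j}\Bigr),$$ where the last union is over all pairs of distinct points $p_i,p_j\in K$ and all minimal circular arcs $\widehat{p_ip_j}$ meeting $p_i$ and $p_j$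 of all spheres $S(x,1)$ through $p_i$ and $p_j$. -/

import Mathlib

/-- The `r`-ball hull of `K`: the intersection of all balls of radius `r` that contain `K`. -/
def ballHullRadius {E : Type*} [NormedAddCommGroup E] (K : Set E) (r : ℝ) : Set E :=
  ⋂ (x : E) (_ : K ⊆ Metric.closedBall x r), Metric.closedBall x r

/-- The ball hull of `K`: the `r`-ball hull with `r` the diameter of `K`. -/
noncomputable def ballHull {E : Type*} [NormedAddCommGroup E] (K : Set E) : Set E :=
  ballHullRadius K (Metric.diam K)

/-- `A` is a circular arc of the sphere with center `x` and radius `r` meeting `p` and `q`: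
a simple (Jordan) arc contained in that sphere with endpoints `p` and `q`
(in particular `p ≠ q`). -/
def IsCircularArc {E : Type*} [NormedAddCommGroup E] (x : E) (r : ℝ) (p q : E)
    (A : Set E) : Prop :=
  A ⊆ Metric.sphere x r ∧
    ∃ γ : ℝ → E, ContinuousOn γ (Set.Icc 0 1) ∧ Set.InjOn γ (Set.Icc 0 1) ∧
      γ 0 = p ∧ γ 1 = q ∧ γ '' Set.Icc 0 1 = A

/-- `A` is a minimal circular arc of the ball with center `x` and radius `r` meeting `p` and `q`:
a circular arc of the sphere with endpoints `p` and `q` that lies in the closed half-plane bounded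
by the line through `p` and `q` on the side not containing the center `x`.  If `p` and `q` are
opposite points, then `x` is on the line, the half-plane condition is void, and the minimal arcs
are the two half-circles. -/
def IsMinimalCircularArc {E : Type*} [NormedAddCommGroup E] [NormedSpace ℝ E]
    (x : E) (r : ℝ) (p q : E) (A : Set E) : Prop :=
  IsCircularArc x r p q A ∧
    ∀ z ∈ A, (affineSpan ℝ {p, q}).WOppSide x z

/-- The family of all balls of radius `1` whose boundary sphere contains a circular arc
meeting two points of `K`. -/
def unitBallsWithArc {E : Type*} [NormedAddCommGroup E] (K : Set E) : Set (Set E) :=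
  {D | ∃ x : E, D = Metric.closedBall x 1 ∧
    ∃ p ∈ K, ∃ q ∈ K, ∃ A : Set E, IsCircularArc x 1 p q A}

/-- The union of all minimal circular arcs of radius `1` meeting two points of `K`. -/
def minimalArcsUnion {E : Type*} [NormedAddCommGroup E] [NormedSpace ℝ E] (K : Set E) : Set E :=
  {z | ∃ p ∈ K, ∃ q ∈ K, ∃ (x : E) (A : Set E), IsMinimalCircularArc x 1 p q A ∧ z ∈ A}

/-! For unit vectors `u`, `v` with `‖u - v‖ ≤ 1`, the norm of `a • u + b • v` is monotone in `a, b ≥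
0` (`norm_cone_mono`). Hence a unit ball containing two points of a unit sphere at distance at most
`1` contains the arc between them (`norm_cap_sub_le`). Minimal arcs are of this kind
(`IsMinimalCircularArc.mem_cone`), so their convex hull lies in every unit ball containing `K`.

Conversely, separate a point `z` from the hull of the arcs by a functional `f`, and take a unit ball
containing `K` whose center is lowest for `f`. By first-order optimality its top point has the
height of a point of `K` or lies on a minimal arc (`exists_top_point`). So `f` is smaller on the
whole ball than at `z`, and the ball excludes `z`.

For the balls with arcs: if a unit ball containing `K` excludes `z`, push it away from `z` until
some `k` in `K` is on its boundary, then move it with `k` kept on the boundary and `z` outside. The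
admissible centers form a connected set (`isPreconnected_sphere_superlevel`), and for some of them
another given point of `K` is not in the interior (`exists_norm_add_gt_and_norm_add_ge`). Hence a
second point of `K` meets the boundary on the way. -/

/-- A closed ball of a normed space is convex along lines: parameters between two admissible
parameters are admissible. -/
theorem norm_add_smul_le_of_between {E : Type*} [NormedAddCommGroup E] [NormedSpace ℝ E]
    {x v : E} {r b₁ b b₂ : ℝ} (h₁ : ‖x + b₁ • v‖ ≤ r) (h₂ : ‖x + b₂ • v‖ ≤ r)
    (hb₁ : b₁ ≤ b) (hb₂ : b ≤ b₂) : ‖x + b • v‖ ≤ r := by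
  rcases eq_or_lt_of_le (hb₁.trans hb₂) with h | h
  · rwa [le_antisymm (hb₂.trans h.symm.le) hb₁]
  have hd : 0 < b₂ - b₁ := sub_pos.2 h
  have key := (convex_closedBall (0 : E) r) (mem_closedBall_zero_iff.2 h₁)
    (mem_closedBall_zero_iff.2 h₂) (div_nonneg (sub_nonneg.2 hb₂) hd.le)
    (div_nonneg (sub_nonneg.2 hb₁) hd.le) (by field_simp; ring)
  rw [mem_closedBall_zero_iff] at key
  have e : x + b • v = ((b₂ - b) / (b₂ - b₁)) • (x + b₁ • v) +
      ((b - b₁) / (b₂ - b₁)) • (x + b₂ • v) := by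
    match_scalars <;> field_simp <;> ring
  rwa [e]

theorem norm_smul_add_smul_le {E : Type*} [NormedAddCommGroup E] [NormedSpace ℝ E]
    (x y : E) {a b : ℝ} (ha : 0 ≤ a) (hb : 0 ≤ b) : ‖a • x + b • y‖ ≤ a * ‖x‖ + b * ‖y‖ := by
  refine (norm_add_le _ _).trans_eq ?_
  rw [norm_smul_of_nonneg ha, norm_smul_of_nonneg hb]

/-! ### Monotonicity of the norm on a narrow cone, and arcs inside unit balls. -/

section Cone

variable {E : Type*} [NormedAddCommGroup E] [NormedSpace ℝ E] {u v : E}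

/-- The convex function `s ↦ ‖b • v + s • u‖` is at most `b` at `-b` and equals `b` at `0`, so it
cannot drop below `b` on the right of `0` and is nondecreasing there. -/
theorem norm_cone_mono_left (hv : ‖v‖ = 1) (huv : ‖u - v‖ ≤ 1)
    {a a' b : ℝ} (ha : 0 ≤ a) (haa : a ≤ a') (hb : 0 ≤ b) :
    ‖a • u + b • v‖ ≤ ‖a' • u + b • v‖ := by
  have hb' : ‖b • v + (-b) • u‖ ≤ b := by
    have : b • v + (-b) • u = (-b) • (u - v) := by module
    rw [this, norm_smul, Real.norm_eq_abs, abs_neg, abs_of_nonneg hb]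
    nlinarith
  have h0 : b ≤ ‖b • v + a' • u‖ := by
    by_contra! hlt
    rcases eq_or_lt_of_le hb with rfl | hb0
    · exact absurd hlt (by simp)
    have hs : 0 < a' + b := by linarith
    have h1 := norm_smul_add_smul_le (b • v + (-b) • u) (b • v + a' • u)
      (ha.trans haa) hb
    have h2 : a' • (b • v + (-b) • u) + b • (b • v + a' • u) = ((a' + b) * b) • v := by module
    rw [h2, norm_smul_of_nonneg (by positivity), hv] at h1
    nlinarith [ha.trans haa]
  rw [add_comm (a • u), add_comm (a' • u)]
  refine norm_add_smul_le_of_between (b₁ := 0) ?_ le_rfl ha haa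
  simpa [norm_smul, hv, abs_of_nonneg hb] using h0

theorem norm_cone_mono (hu : ‖u‖ = 1) (hv : ‖v‖ = 1) (huv : ‖u - v‖ ≤ 1)
    {a a' b b' : ℝ} (ha : 0 ≤ a) (haa : a ≤ a') (hb : 0 ≤ b) (hbb : b ≤ b') :
    ‖a • u + b • v‖ ≤ ‖a' • u + b' • v‖ := by
  refine (norm_cone_mono_left hv huv ha haa hb).trans ?_
  rw [add_comm, add_comm (a' • u)]
  exact norm_cone_mono_left hu (by rwa [norm_sub_rev]) hb hbb (ha.trans haa)

/-- Write `y = c • u + d • v`. If `d ≤ b`, monotonicity suffices. Otherwise the difference lies on a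
line parallel to `v`, between `a • (u - y) + (1 - a) • (v - y)` and `(a - c) • u`. -/
theorem norm_cap_sub_le_of_nonneg_of_nonneg (hu : ‖u‖ = 1) (hv : ‖v‖ = 1) (huv : ‖u - v‖ ≤ 1)
    {a b c d : ℝ} (ha : 0 ≤ a) (hb : 0 ≤ b) (hw : ‖a • u + b • v‖ = 1)
    (hyu : ‖u - (c • u + d • v)‖ ≤ 1) (hyv : ‖v - (c • u + d • v)‖ ≤ 1)
    (hc : 0 ≤ c) (hca : c ≤ a) (hd : 0 ≤ d) :
    ‖a • u + b • v - (c • u + d • v)‖ ≤ 1 := by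
  have hab : 1 ≤ a + b := by
    have := norm_smul_add_smul_le u v ha hb
    rw [hw, hu, hv] at this; linarith
  have ha1 : a ≤ 1 := by
    have := norm_cone_mono hu hv huv ha le_rfl le_rfl hb
    rw [hw] at this; simpa [norm_smul, hu, abs_of_nonneg ha] using this
  rcases le_total d b with hdb | hbd
  · have := norm_cone_mono hu hv huv (sub_nonneg.2 hca) (sub_le_self a hc)
      (sub_nonneg.2 hdb) (sub_le_self b hd)
    rw [hw] at this
    convert this using 2; module
  · have h1 := norm_smul_add_smul_le (u - (c • u + d • v)) (v - (c • u + d • v)) ha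
      (sub_nonneg.2 ha1)
    have e1 : a • u + b • v - (c • u + d • v) = (a - c) • u + (b - d) • v := by module
    rw [e1]
    refine norm_add_smul_le_of_between (b₁ := 1 - a - d) (b₂ := 0) ?_ ?_ (by linarith)
      (by linarith)
    · have e2 : (a - c) • u + (1 - a - d) • v =
        a • (u - (c • u + d • v)) + (1 - a) • (v - (c • u + d • v)) := by module
      rw [e2]; nlinarith
    · simp only [zero_smul, add_zero, norm_smul_of_nonneg (sub_nonneg.2 hca), hu]
      linarith

/-- Write `w = a • u + b • v` and `y = c • u + d • v`. The vector `w - y` is compared with vectors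
of the same `u`-coordinate: a convex combination of `w` and `v` if `c ≤ a`; otherwise one of `u -
y`, `v - y` and one of `v - y`, `v`, on either side of it. -/
theorem norm_cap_sub_le_of_nonneg_of_neg (hu : ‖u‖ = 1) (hv : ‖v‖ = 1) (huv : ‖u - v‖ ≤ 1)
    {a b c d : ℝ} (ha : 0 ≤ a) (hb : 0 ≤ b) (hw : ‖a • u + b • v‖ = 1)
    (hyu : ‖u - (c • u + d • v)‖ ≤ 1) (hyv : ‖v - (c • u + d • v)‖ ≤ 1)
    (hc : 0 < c) (hd : d ≤ 0) :
    ‖a • u + b • v - (c • u + d • v)‖ ≤ 1 := by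
  have hab : 1 ≤ a + b := by
    have := norm_smul_add_smul_le u v ha hb
    rw [hw, hu, hv] at this; linarith
  have hbd : c * b ≤ c + a * d := by
    have h1 := norm_smul_add_smul_le (v - (c • u + d • v)) (a • u + b • v) ha hc.le
    have e : a • (v - (c • u + d • v)) + c • (a • u + b • v) = (a * (1 - d) + c * b) • v := by
      module
    rw [e, norm_smul_of_nonneg (by nlinarith), hv, hw] at h1
    nlinarith
  have e1 : a • u + b • v - (c • u + d • v) = (a - c) • u + (b - d) • v := by module
  rw [e1]
  rcases le_or_gt c a with hca | hca
  · have ha0 : 0 < a := hc.trans_le hca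
    have h1 := norm_smul_add_smul_le (a • u + b • v) v
      (sub_nonneg.2 ((div_le_one ha0).2 hca)) (div_nonneg hc.le ha)
    rw [hw, hv] at h1
    have e2 : (1 - c / a) • (a • u + b • v) + (c / a) • v =
        (a - c) • u + (b + c / a * (1 - b)) • v := by
      match_scalars <;> field_simp
      ring
    rw [e2] at h1
    refine (norm_cone_mono hu hv huv (sub_nonneg.2 hca) le_rfl (by linarith) ?_).trans
      (h1.trans_eq (by ring))
    have : -d ≤ c / a * (1 - b) := by
      rw [div_mul_eq_mul_div, le_div_iff₀ ha0]; nlinarith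
    linarith
  · have hac : a / c ≤ 1 := (div_le_one hc).2 hca.le
    have hac0 : 0 ≤ a / c := div_nonneg ha hc.le
    have ha1 : a ≤ 1 := by
      have := norm_cone_mono hu hv huv ha le_rfl le_rfl hb
      rw [hw] at this; simpa [norm_smul, hu, abs_of_nonneg ha] using this
    refine norm_add_smul_le_of_between (b₁ := 1 - a - d) (b₂ := 1 - d + a / c * d) ?_ ?_
      (by linarith) ?_
    · have h1 := norm_smul_add_smul_le (u - (c • u + d • v)) (v - (c • u + d • v)) ha
        (sub_nonneg.2 ha1)
      have e2 : (a - c) • u + (1 - a - d) • v =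
        a • (u - (c • u + d • v)) + (1 - a) • (v - (c • u + d • v)) := by module
      rw [e2]; nlinarith
    · have h1 := norm_smul_add_smul_le (v - (c • u + d • v)) v (sub_nonneg.2 hac) hac0
      have e2 : (a - c) • u + (1 - d + a / c * d) • v =
          (1 - a / c) • (v - (c • u + d • v)) + (a / c) • v := by
        match_scalars <;> field_simp <;> ring
      rw [e2, ← sub_nonneg]; rw [hv] at h1; nlinarith
    · have : b ≤ 1 + a / c * d := by
        rw [div_mul_eq_mul_div, ← sub_le_iff_le_add', le_div_iff₀ hc]; nlinarith
      linarith

/-- If two points at distance at most `1` of the unit sphere lie in a ball of radius `1`, then so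
does the arc of the unit sphere between them. -/
theorem norm_cap_sub_le (hu : ‖u‖ = 1) (hv : ‖v‖ = 1) (huv : ‖u - v‖ ≤ 1)
    {a b c d : ℝ} (ha : 0 ≤ a) (hb : 0 ≤ b) (hw : ‖a • u + b • v‖ = 1)
    (hyu : ‖u - (c • u + d • v)‖ ≤ 1) (hyv : ‖v - (c • u + d • v)‖ ≤ 1) :
    ‖a • u + b • v - (c • u + d • v)‖ ≤ 1 := by
  have hvu : ‖v - u‖ ≤ 1 := by rwa [norm_sub_rev]
  have hw' : ‖b • v + a • u‖ = 1 := by rwa [add_comm]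
  have hyu' : ‖u - (d • v + c • u)‖ ≤ 1 := by rwa [add_comm (d • v)]
  have hyv' : ‖v - (d • v + c • u)‖ ≤ 1 := by rwa [add_comm (d • v)]
  rcases lt_or_ge 0 c with hc | hc <;> rcases lt_or_ge 0 d with hd | hd
  · rcases le_total c a with hca | hac
    · exact norm_cap_sub_le_of_nonneg_of_nonneg hu hv huv ha hb hw hyu hyv hc.le hca hd.le
    rcases le_total d b with hdb | hbd
    · have := norm_cap_sub_le_of_nonneg_of_nonneg hv hu hvu hb ha hw' hyv' hyu' hd.le hdb hc.le
      rwa [add_comm (b • v), add_comm (d • v)] at this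
    -- Here both coordinates of `y` exceed those of `w`. The chord point `(1 - b) • u + b • v` has
    -- the same `v`-coordinate as `w` and is at least as far from `y`.
    · have hab : 1 ≤ a + b := by
        have := norm_smul_add_smul_le u v ha hb
        rw [hw, hu, hv] at this; linarith
      have hb1 : b ≤ 1 := by
        have := norm_cone_mono hu hv huv le_rfl ha hb le_rfl
        rw [hw] at this; simpa [norm_smul, hv, abs_of_nonneg hb] using this
      have h1 := norm_smul_add_smul_le (u - (c • u + d • v)) (v - (c • u + d • v))
        (sub_nonneg.2 hb1) hb
      have e2 : (1 - b) • (u - (c • u + d • v)) + b • (v - (c • u + d • v)) =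
        -((c - (1 - b)) • u + (d - b) • v) := by module
      rw [e2, norm_neg] at h1
      have h2 := norm_cone_mono hu hv huv (sub_nonneg.2 hac)
        (show c - a ≤ c - (1 - b) by linarith) (sub_nonneg.2 hbd) le_rfl
      have e1 : a • u + b • v - (c • u + d • v) = -((c - a) • u + (d - b) • v) := by module
      rw [e1, norm_neg]
      nlinarith
  · exact norm_cap_sub_le_of_nonneg_of_neg hu hv huv ha hb hw hyu hyv hc hd
  · have := norm_cap_sub_le_of_nonneg_of_neg hv hu hvu hb ha hw' hyv' hyu' hd hc
    rwa [add_comm (b • v), add_comm (d • v)] at this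
  · have hc0 : c = 0 := by
      have h1 := norm_cone_mono hu hv huv (a := 1 - c) (by linarith) le_rfl le_rfl (neg_nonneg.2 hd)
      have e : (1 - c) • u + (-d) • v = u - (c • u + d • v) := by module
      rw [e, zero_smul, add_zero, norm_smul_of_nonneg (by linarith), hu] at h1
      linarith
    have hd0 : d = 0 := by
      have h1 := norm_cone_mono hu hv huv (b := 1 - d) le_rfl (neg_nonneg.2 hc) (by linarith) le_rfl
      have e : (-c) • u + (1 - d) • v = v - (c • u + d • v) := by module
      rw [e, zero_smul, zero_add, norm_smul_of_nonneg (by linarith), hv] at h1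
      linarith
    simp [hc0, hd0, hw]

end Cone

/-- By Carathéodory, `finrank + 1` points suffice, so the hull is a finite union of continuous
images of a simplex times a power of `s`. -/
theorem IsCompact.convexHull_of_finiteDimensional {E : Type*} [NormedAddCommGroup E]
    [NormedSpace ℝ E] [FiniteDimensional ℝ E] {s : Set E} (hs : IsCompact s) :
    IsCompact (convexHull ℝ s) := by
  have h : convexHull ℝ s = ⋃ n ∈ Finset.range (Module.finrank ℝ E + 2),
      (fun q : (Fin n → ℝ) × (Fin n → E) => ∑ i, q.1 i • q.2 i) ''
        (stdSimplex ℝ (Fin n) ×ˢ Set.univ.pi fun _ => s) := by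
    apply Set.Subset.antisymm
    · intro x hx
      rw [convexHull_eq_union] at hx
      simp only [Set.mem_iUnion] at hx
      obtain ⟨t, hts, hind, hxt⟩ := hx
      rw [Finset.convexHull_eq] at hxt
      obtain ⟨w, hw0, hw1, hwx⟩ := hxt
      have hcard : t.card ≤ Module.finrank ℝ E + 1 := by
        simpa using hind.card_le_finrank_succ.trans
          (Nat.add_le_add_right (Submodule.finrank_le _) 1)
      simp only [Set.mem_iUnion]
      refine ⟨t.card, Finset.mem_range.2 (by omega), (fun i => w (t.equivFin.symm i),
        fun i => (t.equivFin.symm i : E)), ⟨⟨fun i => hw0 _ (t.equivFin.symm i).2, ?_⟩,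
        fun i _ => hts (t.equivFin.symm i).2⟩, ?_⟩
      · rw [← hw1, ← Finset.sum_coe_sort t w]
        exact Equiv.sum_comp t.equivFin.symm (fun i : t => w i)
      · rw [← hwx, Finset.centerMass_eq_of_sum_1 _ _ hw1,
          ← Finset.sum_coe_sort t (fun i => w i • id i)]
        exact Equiv.sum_comp t.equivFin.symm (fun i : t => w i • (i : E))
    · simp only [Set.iUnion_subset_iff]
      rintro n - _ ⟨q, ⟨⟨hq0, hq1⟩, hqs⟩, rfl⟩
      exact (convex_convexHull ℝ s).sum_mem (fun i _ => hq0 i) hq1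
        fun i _ => subset_convexHull ℝ s (hqs i trivial)
  rw [h]
  refine Finset.isCompact_biUnion _ fun n _ => IsCompact.image
    ((isCompact_stdSimplex ℝ _).prod (isCompact_univ_pi fun _ => hs)) (by fun_prop)

/-! ### Coordinates in the plane. -/

section Coordinates

variable {E : Type*} [NormedAddCommGroup E] [NormedSpace ℝ E]

/-- Coordinate functionals of two independent vectors of a plane. -/
theorem exists_plane_coordinates (hE : Module.finrank ℝ E = 2) {u v : E}
    (h : LinearIndependent ℝ ![u, v]) : ∃ φ ψ : E →L[ℝ] ℝ,
      φ u = 1 ∧ φ v = 0 ∧ ψ u = 0 ∧ ψ v = 1 ∧ ∀ y, y = φ y • u + ψ y • v := by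
  have : FiniteDimensional ℝ E := Module.finite_of_finrank_pos (by omega)
  let b := basisOfLinearIndependentOfCardEqFinrank h (by simp [hE])
  have hb : ⇑b = ![u, v] := coe_basisOfLinearIndependentOfCardEqFinrank _ _
  have hb0 : b 0 = u := by simp [hb]
  have hb1 : b 1 = v := by simp [hb]
  refine ⟨(b.coord 0).toContinuousLinearMap, (b.coord 1).toContinuousLinearMap,
    ?_, ?_, ?_, ?_, fun y => ?_⟩
  · simp [← hb0]
  · simp [← hb1]
  · simp [← hb0]
  · simp [← hb1]
  · have := b.sum_repr y
    rw [Fin.sum_univ_two, hb0, hb1] at this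
    exact this.symm

/-- The only other unit multiple of `u` is `-u`, at distance `2`. Thus opposite end points never
occur for points at distance at most `1`. -/
theorem linearIndependent_of_norm_sub_le {u v : E} (hu : ‖u‖ = 1) (hv : ‖v‖ = 1)
    (huv : ‖u - v‖ ≤ 1) (hne : u ≠ v) : LinearIndependent ℝ ![u, v] := by
  rw [LinearIndependent.pair_iff' (by rintro rfl; simp at hu)]
  rintro a rfl
  rw [norm_smul, hu, mul_one, Real.norm_eq_abs] at hv
  rcases eq_or_eq_neg_of_abs_eq hv with rfl | rfl
  · simp at hne
  · have : u - (-1 : ℝ) • u = (2 : ℝ) • u := by module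
    rw [this, norm_smul, hu] at huv
    norm_num at huv

theorem smul_add_smul_ne_zero {u v : E} (h : LinearIndependent ℝ ![u, v]) {a b : ℝ}
    (hab : a ≠ 0 ∨ b ≠ 0) : a • u + b • v ≠ 0 := by
  intro h0
  have := (LinearIndependent.pair_iff.1 h) a b h0
  tauto

end Coordinates

/-! ### Radial projections of chords as minimal arcs. -/

section Arcs

variable {E : Type*} [NormedAddCommGroup E] [NormedSpace ℝ E]

/-- The radial projection to the unit sphere around `x` of the segment from `p` to `q`. -/
noncomputable def normArc (x p q : E) (s : ℝ) : E :=
  x + ‖(1 - s) • (p - x) + s • (q - x)‖⁻¹ • ((1 - s) • (p - x) + s • (q - x))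

theorem normArc_segment_ne_zero {u v : E} (h : LinearIndependent ℝ ![u, v]) (s : ℝ) :
    (1 - s) • u + s • v ≠ 0 := by
  refine smul_add_smul_ne_zero h ?_
  by_cases hs : s = 0
  · left; simp [hs]
  · right; exact hs

theorem norm_normArc_sub {x p q : E} {s : ℝ} (h : (1 - s) • (p - x) + s • (q - x) ≠ 0) :
    ‖normArc x p q s - x‖ = 1 := by
  rw [normArc, add_sub_cancel_left, norm_smul, norm_inv, norm_norm,
    inv_mul_cancel₀ (norm_ne_zero_iff.2 h)]

theorem normArc_zero {x p : E} (hp : ‖p - x‖ = 1) (q : E) : normArc x p q 0 = p := by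
  simp [normArc, hp]

theorem normArc_one {x q : E} (hq : ‖q - x‖ = 1) (p : E) : normArc x p q 1 = q := by
  simp [normArc, hq]

theorem continuousOn_normArc {p q : E} {S : Set (E × ℝ)}
    (h : ∀ y ∈ S, (1 - y.2) • (p - y.1) + y.2 • (q - y.1) ≠ 0) :
    ContinuousOn (fun y : E × ℝ => normArc y.1 p q y.2) S := by
  unfold normArc
  exact continuousOn_fst.add (ContinuousOn.smul (ContinuousOn.inv₀ (by fun_prop)
    fun y hy => norm_ne_zero_iff.2 (h y hy)) (by fun_prop))

/-- Chord points have distance at most `1` from `x`, so the projection pushes them away from `x`,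
beyond the chord. Injectivity follows from linear independence. -/
theorem isMinimalCircularArc_normArc {x p q : E} (hp : ‖p - x‖ = 1) (hq : ‖q - x‖ = 1)
    (hpq : ‖p - q‖ ≤ 1) (hne : p ≠ q) :
    IsMinimalCircularArc x 1 p q (normArc x p q '' Set.Icc 0 1) := by
  have hind : LinearIndependent ℝ ![p - x, q - x] :=
    linearIndependent_of_norm_sub_le hp hq (by simpa using hpq) (by simpa using hne)
  have hm := normArc_segment_ne_zero hind
  refine ⟨⟨?_, normArc x p q, ?_, ?_, normArc_zero hp q, normArc_one hq p, rfl⟩, ?_⟩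
  · rintro _ ⟨s, -, rfl⟩
    exact mem_sphere_iff_norm.2 (norm_normArc_sub (hm s))
  · exact (continuousOn_normArc (S := Set.univ.image (Prod.mk x)) (by
      rintro _ ⟨s, -, rfl⟩; exact hm s)).comp (by fun_prop) fun s _ => ⟨s, trivial, rfl⟩
  · intro s _ s' _ h
    simp only [normArc, add_right_inj] at h
    set r := ‖(1 - s) • (p - x) + s • (q - x)‖⁻¹
    set r' := ‖(1 - s') • (p - x) + s' • (q - x)‖⁻¹
    have hr : r ≠ 0 := inv_ne_zero (norm_ne_zero_iff.2 (hm s))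
    have h0 : (r * (1 - s) - r' * (1 - s')) • (p - x) + (r * s - r' * s') • (q - x) = 0 := by
      rw [← sub_eq_zero] at h
      rw [← h]; module
    obtain ⟨h1, h2⟩ := LinearIndependent.pair_iff.1 hind _ _ h0
    have hrr : r = r' := by linarith
    rw [← hrr, ← mul_sub, mul_eq_zero] at h2
    exact sub_eq_zero.1 (h2.resolve_left hr)
  · rintro _ ⟨s, ⟨hs0, hs1⟩, rfl⟩
    refine ⟨AffineMap.lineMap p q s, AffineMap.lineMap_mem_affineSpan_pair _ _ _,
      AffineMap.lineMap p q s, AffineMap.lineMap_mem_affineSpan_pair _ _ _, ?_⟩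
    set m := (1 - s) • (p - x) + s • (q - x) with hmdef
    have hm1 : ‖m‖ ≤ 1 := by
      have := norm_smul_add_smul_le (p - x) (q - x) (sub_nonneg.2 hs1) hs0
      rw [hp, hq] at this; linarith
    have hl : AffineMap.lineMap p q s = x + m := by
      rw [AffineMap.lineMap_apply_module, hmdef]; module
    have hm0 : 0 < ‖m‖ := norm_pos_iff.2 (hm s)
    have e1 : x -ᵥ (x + m) = -m := by simp
    have e2 : (x + m) -ᵥ normArc x p q s = (‖m‖⁻¹ - 1) • (-m) := by
      rw [normArc, ← hmdef, vsub_eq_sub]; module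
    rw [hl, e1, e2]
    exact SameRay.sameRay_nonneg_smul_right _ (sub_nonneg.2 ((one_le_inv₀ hm0).2 hm1))

/-- A unit vector in the cone spanned by two unit vectors lies on the radial projection of the
segment joining them. -/
theorem add_mem_image_normArc {x p q t : E} {a b : ℝ} (ha : 0 ≤ a) (hb : 0 ≤ b) (ht : ‖t‖ = 1)
    (h : t = a • (p - x) + b • (q - x)) : x + t ∈ normArc x p q '' Set.Icc 0 1 := by
  have hab : 0 < a + b := by
    by_contra! hab
    have ha0 : a = 0 := by linarith
    have hb0 : b = 0 := by linarith
    rw [h, ha0, hb0] at ht; simp at ht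
  refine ⟨b / (a + b), ⟨by positivity, (div_le_one hab).2 (by linarith)⟩, ?_⟩
  have e : (1 - b / (a + b)) • (p - x) + (b / (a + b)) • (q - x) = (a + b)⁻¹ • t := by
    rw [h]; match_scalars <;> field_simp <;> ring
  rw [normArc, e, norm_smul, ht, mul_one, Real.norm_of_nonneg (by positivity), inv_inv, smul_smul,
    mul_inv_cancel₀ hab.ne', one_smul]

end Arcs

/-! ### Position of an arbitrary minimal arc. -/

section MinimalArcs

variable {E : Type*} [NormedAddCommGroup E] [NormedSpace ℝ E]

/-- If the chord of two points of the unit sphere extends to a third point of the sphere, then the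
sphere lies on one side of the chord. -/
theorem add_le_one_of_face {u v : E} (hu : ‖u‖ = 1) (hv : ‖v‖ = 1) {a b : ℝ} (ha : a < 0)
    (hab : 1 ≤ a + b) (hw : ‖a • u + b • v‖ = 1) {c d : ℝ}
    (hz : ‖c • u + d • v‖ = 1) : a + b = 1 ∧ c + d ≤ 1 := by
  obtain ⟨h, hh, hhv⟩ := exists_dual_vector ℝ v (by simp [hv])
  have hle (y : E) : h y ≤ ‖y‖ := by
    have := h.le_opNorm y
    rw [hh, one_mul] at this
    exact (le_abs_self _).trans this
  simp only [hv, RCLike.ofReal_real_eq_id, id_eq] at hhv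
  have h1 := hle u
  have h2 := hle (a • u + b • v)
  have h3 := hle (c • u + d • v)
  rw [hu] at h1
  rw [hw] at h2
  rw [hz] at h3
  simp only [map_add, map_smul, smul_eq_mul, hhv, mul_one] at h2 h3
  -- From `a < 0` and `h u ≤ 1`: `1 ≤ a + b ≤ a * h u + b ≤ 1`.
  have h4 : h u = 1 := by nlinarith
  rw [h4] at h2 h3
  constructor <;> linarith

/-- Points of a minimal arc lie in the cone of its end points, seen from the center. -/
theorem IsMinimalCircularArc.mem_cone (hE : Module.finrank ℝ E = 2) {x p q : E} {A : Set E}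
    (hA : IsMinimalCircularArc x 1 p q A) (hpq : ‖p - q‖ ≤ 1) {z : E} (hz : z ∈ A) :
    ‖p - x‖ = 1 ∧ ‖q - x‖ = 1 ∧ p ≠ q ∧
      ∃ a b : ℝ, 0 ≤ a ∧ 0 ≤ b ∧ z - x = a • (p - x) + b • (q - x) := by
  obtain ⟨⟨hS, γ, hγc, hγi, hγ0, hγ1, rfl⟩, hopp⟩ := hA
  have h0 : (0 : ℝ) ∈ Set.Icc (0 : ℝ) 1 := by simp
  have h1 : (1 : ℝ) ∈ Set.Icc (0 : ℝ) 1 := by simp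
  have hS' (s : ℝ) (hs : s ∈ Set.Icc (0 : ℝ) 1) : ‖γ s - x‖ = 1 :=
    mem_sphere_iff_norm.1 (hS ⟨s, hs, rfl⟩)
  have hp : ‖p - x‖ = 1 := hγ0 ▸ hS' 0 h0
  have hq : ‖q - x‖ = 1 := hγ1 ▸ hS' 1 h1
  have hne : p ≠ q := by
    rw [← hγ0, ← hγ1]; exact fun h => zero_ne_one (hγi h0 h1 h)
  refine ⟨hp, hq, hne, ?_⟩
  obtain ⟨φ, ψ, hφp, hφq, hψp, hψq, hφψ⟩ := exists_plane_coordinates hE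
    (linearIndependent_of_norm_sub_le hp hq (by simpa using hpq) (by simpa using hne))
  have hline (l : E) (hl : l ∈ affineSpan ℝ {p, q}) : φ (l - x) + ψ (l - x) = 1 := by
    obtain ⟨r, rfl⟩ := mem_affineSpan_pair_iff_exists_lineMap_eq.1 hl
    have : AffineMap.lineMap p q r - x = (1 - r) • (p - x) + r • (q - x) := by
      rw [AffineMap.lineMap_apply_module]; module
    rw [this]
    simp only [map_add, map_smul, smul_eq_mul, hφp, hφq, hψp, hψq]
    ring
  have hside (s : ℝ) (hs : s ∈ Set.Icc (0 : ℝ) 1) : 1 ≤ φ (γ s - x) + ψ (γ s - x) := by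
    obtain ⟨l₁, hl₁, l₂, hl₂, hray⟩ := hopp (γ s) ⟨s, hs, rfl⟩
    have e₁ : φ (x - l₁) + ψ (x - l₁) = -1 := by
      have := hline l₁ hl₁
      rw [← neg_sub l₁ x, map_neg, map_neg]; linarith
    have e₂ : φ (l₂ - γ s) + ψ (l₂ - γ s) = 1 - (φ (γ s - x) + ψ (γ s - x)) := by
      have := hline l₂ hl₂
      rw [← sub_sub_sub_cancel_right l₂ (γ s) x, map_sub, map_sub ψ]; linarith
    rcases hray with h | h | ⟨r₁, r₂, hr₁, hr₂, h⟩
    · rw [vsub_eq_sub] at h; rw [h] at e₁; simp at e₁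
    · rw [vsub_eq_sub] at h; rw [h] at e₂
      simp only [map_zero] at e₂; linarith
    · simp only [vsub_eq_sub] at h
      have h' := congrArg (fun y => φ y + ψ y) h
      simp only [map_smul, smul_eq_mul] at h'
      have h'' : r₁ * (-1) = r₂ * (1 - (φ (γ s - x) + ψ (γ s - x))) := by
        rw [← e₁, ← e₂]; linarith
      by_contra! hlt
      nlinarith [mul_pos hr₂ (sub_pos.2 hlt)]
  have hw (s : ℝ) (hs : s ∈ Set.Icc (0 : ℝ) 1) :
      ‖φ (γ s - x) • (p - x) + ψ (γ s - x) • (q - x)‖ = 1 := by rw [← hφψ, hS' s hs]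
  have hinj (s s' : ℝ) (hs : s ∈ Set.Icc (0 : ℝ) 1) (hs' : s' ∈ Set.Icc (0 : ℝ) 1)
      (hφs : φ (γ s - x) + ψ (γ s - x) = 1) (hφs' : φ (γ s' - x) + ψ (γ s' - x) = 1)
      (h : ψ (γ s - x) = ψ (γ s' - x)) : s = s' := by
    refine hγi hs hs' (sub_left_injective (b := x) ?_)
    simp only
    rw [hφψ (γ s - x), hφψ (γ s' - x), h,
      show φ (γ s - x) = φ (γ s' - x) by linarith]
  have hψc : ContinuousOn (fun s => ψ (γ s - x)) (Set.Icc 0 1) :=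
    ψ.continuous.comp_continuousOn (hγc.sub continuousOn_const)
  obtain ⟨s, hs, rfl⟩ := hz
  refine ⟨φ (γ s - x), ψ (γ s - x), ?_, ?_, hφψ _⟩
  -- A negative coordinate puts the whole arc on the line through `p` and `q`, where `ψ` is an
  -- injective parameter. Going from `p` to a point beyond `q`, the arc would pass through `q`
  -- before its end.
  · by_contra! hneg
    have hall (r : ℝ) (hr : r ∈ Set.Icc (0 : ℝ) 1) : φ (γ r - x) + ψ (γ r - x) = 1 :=
      le_antisymm (add_le_one_of_face hp hq hneg (hside s hs) (hw s hs) (hw r hr)).2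
        (hside r hr)
    obtain ⟨r, hr, hr'⟩ := intermediate_value_Icc hs.1
      (hψc.mono (Set.Icc_subset_Icc le_rfl hs.2))
      (show (1 : ℝ) ∈ Set.Icc _ _ by
        rw [hγ0, hψp]; exact ⟨zero_le_one, by linarith [hside s hs]⟩)
    have hr1 : r ∈ Set.Icc (0 : ℝ) 1 := ⟨hr.1, hr.2.trans hs.2⟩
    have := hinj r 1 hr1 h1 (hall r hr1) (hall 1 h1) (by rw [hγ1, hψq]; exact hr')
    have hs1 : s = 1 := le_antisymm hs.2 (this ▸ hr.2)
    rw [hs1, hγ1, hφq] at hneg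
    exact lt_irrefl _ hneg
  · by_contra! hneg
    have hall (r : ℝ) (hr : r ∈ Set.Icc (0 : ℝ) 1) : φ (γ r - x) + ψ (γ r - x) = 1 := by
      refine le_antisymm ?_ (hside r hr)
      rw [add_comm]
      exact (add_le_one_of_face hq hp hneg (by rw [add_comm]; exact hside s hs)
        (by rw [add_comm, hw s hs]) (by rw [add_comm, hw r hr])).2
    obtain ⟨r, hr, hr'⟩ := intermediate_value_Icc hs.2
      (hψc.mono (Set.Icc_subset_Icc hs.1 le_rfl))
      (show (0 : ℝ) ∈ Set.Icc _ _ by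
        rw [hγ1, hψq]; exact ⟨hneg.le, zero_le_one⟩)
    have hr1 : r ∈ Set.Icc (0 : ℝ) 1 := ⟨hs.1.trans hr.1, hr.2⟩
    have := hinj r 0 hr1 h0 (hall r hr1) (hall 0 h0) (by rw [hγ0, hψp]; exact hr')
    have hs1 : s = 0 := le_antisymm (this ▸ hr.1) hs.1
    rw [hs1, hγ0, hψp] at hneg
    exact lt_irrefl _ hneg

/-- A ball of radius `1` containing two points at distance at most `1` contains all minimal arcs
meeting these points. -/
theorem IsMinimalCircularArc.subset_closedBall (hE : Module.finrank ℝ E = 2) {x y p q : E}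
    {A : Set E} (hA : IsMinimalCircularArc x 1 p q A) (hpq : ‖p - q‖ ≤ 1)
    (hp : p ∈ Metric.closedBall y 1) (hq : q ∈ Metric.closedBall y 1) :
    A ⊆ Metric.closedBall y 1 := by
  intro z hz
  obtain ⟨hpx, hqx, hne, a, b, ha, hb, hab⟩ := hA.mem_cone hE hpq hz
  have hpq' : ‖(p - x) - (q - x)‖ ≤ 1 := by simpa using hpq
  obtain ⟨φ, ψ, -, -, -, -, hφψ⟩ := exists_plane_coordinates hE
    (linearIndependent_of_norm_sub_le hpx hqx hpq' (by simpa using hne))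
  rw [mem_closedBall_iff_norm] at hp hq ⊢
  have hz1 : ‖z - x‖ = 1 := mem_sphere_iff_norm.1 (hA.1.1 hz)
  have := norm_cap_sub_le hpx hqx hpq' ha hb (hab ▸ hz1) (c := φ (y - x)) (d := ψ (y - x))
    (by rwa [← hφψ, sub_sub_sub_cancel_right]) (by rwa [← hφψ, sub_sub_sub_cancel_right])
  rwa [← hab, ← hφψ, sub_sub_sub_cancel_right] at this

end MinimalArcs

/-! ### The top point of a lowest unit ball containing `K`. -/

section TopPoint

variable {E : Type*} [NormedAddCommGroup E] [NormedSpace ℝ E]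

theorem ContinuousLinearMap.exists_norm_attaining [FiniteDimensional ℝ E] {f : E →L[ℝ] ℝ}
    (hf : f ≠ 0) : ∃ (c : ℝ) (t : E), 0 < c ∧ ‖t‖ = 1 ∧ f t = c ∧ ∀ y, f y ≤ c * ‖y‖ := by
  have : Nontrivial E := by
    by_contra h
    rw [not_nontrivial_iff_subsingleton] at h
    exact hf (ContinuousLinearMap.ext fun y => by rw [Subsingleton.elim y 0]; simp)
  obtain ⟨t, ht, hmax⟩ := (isCompact_sphere (0 : E) 1).exists_isMaxOn
    (NormedSpace.sphere_nonempty.2 zero_le_one) f.continuous.continuousOn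
  have hle (y : E) : f y ≤ f t * ‖y‖ := by
    rcases eq_or_ne y 0 with rfl | hy
    · simp
    have hy' : 0 < ‖y‖ := norm_pos_iff.2 hy
    have : f (‖y‖⁻¹ • y) ≤ f t := hmax (by simp [norm_smul, hy])
    rwa [map_smul, smul_eq_mul, inv_mul_le_iff₀ hy', mul_comm] at this
  refine ⟨f t, t, ?_, by simpa using ht, rfl, hle⟩
  by_contra! h
  refine hf (ContinuousLinearMap.ext fun y => le_antisymm ?_ ?_)
  · exact (hle y).trans (mul_nonpos_of_nonpos_of_nonneg h (norm_nonneg _))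
  · have := (hle (-y)).trans (mul_nonpos_of_nonpos_of_nonneg h (norm_nonneg _))
    simpa using this

/-- A functional with `f t = 1` is the first coordinate of a basis of the plane starting
with `t`. -/
theorem exists_complementary_coordinate (hE : Module.finrank ℝ E = 2) {f : E →L[ℝ] ℝ} {t : E}
    (ht : f t = 1) : ∃ (e : E) (g : E →L[ℝ] ℝ), g t = 0 ∧ g e = 1 ∧
      ∀ y, y = f y • t + g y • e := by
  have ht0 : t ≠ 0 := by rintro rfl; simp at ht
  obtain ⟨e, he⟩ := exists_linearIndependent_pair_of_one_lt_finrank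
    (show 1 < Module.finrank ℝ E by omega) ht0
  obtain ⟨φ, ψ, -, -, hψt, hψe, h⟩ := exists_plane_coordinates hE he
  refine ⟨e - f e • t, ψ, hψt, by simp [hψt, hψe], fun y => ?_⟩
  have hf : f y = φ y + ψ y * f e := by
    conv_lhs => rw [h y]
    simp [ht]
  conv_lhs => rw [h y]
  rw [hf]; module

theorem one_lt_rank_of_finrank_eq_two (hE : Module.finrank ℝ E = 2) :
    1 < Module.rank ℝ E := by
  have : FiniteDimensional ℝ E := Module.finite_of_finrank_pos (by omega)
  rw [← Module.finrank_eq_rank, hE]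
  norm_num

/-- On the connected sphere around `p`, the distance to `q` takes the values `1 - ‖p - q‖` and `1 +
‖p - q‖`, hence also `1`. -/
theorem exists_unit_center (hE : Module.finrank ℝ E = 2) {p q : E} (hne : p ≠ q)
    (hpq : ‖p - q‖ ≤ 1) : ∃ x, ‖p - x‖ = 1 ∧ ‖q - x‖ = 1 := by
  have hpos : 0 < ‖p - q‖ := norm_pos_iff.2 (sub_ne_zero.2 hne)
  have hconn : IsPreconnected (Metric.sphere p (1 : ℝ)) :=
    isPreconnected_sphere (one_lt_rank_of_finrank_eq_two hE) p 1
  have hunit : ‖‖p - q‖⁻¹ • (p - q)‖ = 1 := by simp [norm_smul, hpos.ne']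
  have h1 : p - ‖p - q‖⁻¹ • (p - q) ∈ Metric.sphere p (1 : ℝ) := by
    rw [mem_sphere_iff_norm, sub_sub_cancel_left, norm_neg, hunit]
  have h2 : p + ‖p - q‖⁻¹ • (p - q) ∈ Metric.sphere p (1 : ℝ) := by
    rw [mem_sphere_iff_norm, add_sub_cancel_left, hunit]
  obtain ⟨x, hx, hx'⟩ := hconn.intermediate_value h1 h2
    (f := fun x => ‖q - x‖) (by fun_prop) (show (1 : ℝ) ∈ Set.Icc _ _ by
      constructor
      · have : q - (p - ‖p - q‖⁻¹ • (p - q)) = (‖p - q‖⁻¹ - 1) • (p - q) := by module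
        rw [this, norm_smul, Real.norm_of_nonneg (sub_nonneg.2 ((one_le_inv₀ hpos).2 hpq)),
          sub_mul, inv_mul_cancel₀ hpos.ne']
        linarith
      · have : q - (p + ‖p - q‖⁻¹ • (p - q)) = (-(‖p - q‖⁻¹ + 1)) • (p - q) := by module
        rw [this, norm_smul, norm_neg, Real.norm_of_nonneg (by positivity),
          add_mul, inv_mul_cancel₀ hpos.ne']
        linarith)
  exact ⟨x, by rw [norm_sub_rev]; exact mem_sphere_iff_norm.1 hx, hx'⟩

/-- First order condition: at a lowest center of a unit ball containing `K` there is no descent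
direction that keeps the active constraints. -/
theorem not_exists_descent {K : Set E} (hK : K.Finite) {f : E →L[ℝ] ℝ} {x : E}
    (hx : ∀ k ∈ K, ‖k - x‖ ≤ 1) (hmin : ∀ x', (∀ k ∈ K, ‖k - x'‖ ≤ 1) → f x ≤ f x') {y : E}
    (hy : ∀ k ∈ K, ‖k - x‖ = 1 → ‖k - x - y‖ ≤ 1) : 0 ≤ f y := by
  have hev : ∀ᶠ r in nhdsWithin (0 : ℝ) (Set.Ioi 0), ∀ k ∈ K, ‖k - (x + r • y)‖ ≤ 1 := by
    refine (Filter.eventually_all_finite hK).2 fun k hk => ?_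
    rcases eq_or_lt_of_le (hx k hk) with h | h
    · filter_upwards [Ioo_mem_nhdsGT (zero_lt_one' ℝ)] with r hr
      have := norm_add_smul_le_of_between (x := k - x) (v := -y) (r := 1) (b₁ := 0) (b₂ := 1)
        (b := r) (by simp [h]) (by simpa [← sub_eq_add_neg] using hy k hk h) hr.1.le hr.2.le
      convert this using 2; module
    · have hc : Filter.Tendsto (fun r : ℝ => ‖k - (x + r • y)‖) (nhds 0) (nhds ‖k - x‖) := by
        have : Continuous fun r : ℝ => ‖k - (x + r • y)‖ := by fun_prop
        simpa using this.tendsto 0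
      exact ((hc.eventually (eventually_lt_nhds h)).filter_mono nhdsWithin_le_nhds).mono
        fun r hr => hr.le
  obtain ⟨r, hr, hr0⟩ := (hev.and self_mem_nhdsWithin).exists
  have := hmin _ hr
  rw [map_add, map_smul, smul_eq_mul] at this
  exact nonneg_of_mul_nonneg_right (by linarith) (Set.mem_Ioi.1 hr0)

/-- Call `k` active if `‖k - x‖ = 1`. If all active points were on one side, let `k₁` be the one
with the largest `f / g`. Moving the center by `k₁ - x - t`, which makes `k₁` the top point, lowers
it and keeps all active points in the ball. -/
theorem not_forall_coordinate_pos {K : Set E} (hK : K.Finite) {f g : E →L[ℝ] ℝ} {e t : E}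
    (ht : ‖t‖ = 1) (hft : f t = 1) (hfg : ∀ y, y = f y • t + g y • e) {x : E}
    (hx : ∀ k ∈ K, ‖k - x‖ ≤ 1) (hmin : ∀ x', (∀ k ∈ K, ‖k - x'‖ ≤ 1) → f x ≤ f x')
    (hf0 : ∀ k ∈ K, ‖k - x‖ = 1 → 0 ≤ f (k - x)) (hf1 : ∀ k ∈ K, ‖k - x‖ = 1 → f (k - x) < 1) :
    ¬ ∀ k ∈ K, ‖k - x‖ = 1 → 0 < g (k - x) := by
  intro hg
  rcases ({k ∈ K | ‖k - x‖ = 1}).eq_empty_or_nonempty with hA | hA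
  · have := not_exists_descent hK hx hmin (y := -t) fun k hk hk1 =>
      absurd (show k ∈ {k ∈ K | ‖k - x‖ = 1} from ⟨hk, hk1⟩) (by simp [hA])
    rw [map_neg, hft] at this; linarith
  obtain ⟨k₁, ⟨hk₁, hk₁x⟩, hmax⟩ := Set.exists_max_image _ (fun k => f (k - x) / g (k - x))
    (hK.subset (Set.sep_subset K fun k => ‖k - x‖ = 1)) hA
  have := not_exists_descent hK hx hmin (y := k₁ - x - t) fun k hk hkx => ?_
  · rw [map_sub f (k₁ - x), hft] at this
    linarith [hf1 k₁ hk₁ hk₁x]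
  have hgk := hg k hk hkx
  have hgk₁ := hg k₁ hk₁ hk₁x
  have hm := hmax k ⟨hk, hkx⟩
  set u := k - x
  set u₁ := k₁ - x
  -- `α` and `β` are the coordinates of `u₁` with respect to `t` and `u`; the choice of `k₁` gives
  -- `0 ≤ α`. The triangle inequality then yields `1 ≤ α + β` and `β ≤ 1 + α`, one for each case
  -- below.
  set β := g u₁ / g u with hβ
  set α := f u₁ - β * f u with hα
  have hβ0 : 0 < β := div_pos hgk₁ hgk
  have hα0 : 0 ≤ α := by
    rw [div_le_div_iff₀ hgk hgk₁] at hm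
    rw [hα, hβ, div_mul_eq_mul_div, sub_nonneg, div_le_iff₀ hgk]; linarith
  have hα1 : α < 1 := by
    have := mul_nonneg hβ0.le (hf0 k hk hkx)
    linarith [hf1 k₁ hk₁ hk₁x]
  have hu₁ : u₁ = α • t + β • u := by
    conv_lhs => rw [hfg u₁]
    conv_rhs => rw [hfg u]
    have : g u₁ = β * g u := by rw [hβ]; field_simp
    rw [this, hα]; module
  have e1 : u - (u₁ - t) = (1 - α) • t + (1 - β) • u := by rw [hu₁]; module
  rw [e1]
  rcases le_total β 1 with h | h
  · have h1 := norm_smul_add_smul_le t u (sub_nonneg.2 hα1.le) (sub_nonneg.2 h)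
    have h2 := norm_smul_add_smul_le t u hα0 hβ0.le
    rw [← hu₁, hk₁x, ht, hkx] at h2
    rw [ht, hkx] at h1
    linarith
  · have h1 := norm_smul_add_smul_le t (-u) (sub_nonneg.2 hα1.le) (sub_nonneg.2 h)
    have e2 : (1 - α) • t + (β - 1) • -u = (1 - α) • t + (1 - β) • u := by module
    have h2 := norm_smul_add_smul_le u₁ (-t) zero_le_one hα0
    have e3 : (1 : ℝ) • u₁ + α • -t = β • u := by rw [hu₁]; module
    rw [e2, norm_neg, ht, hkx] at h1
    rw [e3, norm_smul_of_nonneg hβ0.le, norm_neg, ht, hkx, hk₁x] at h2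
    linarith

/-- The top point (in direction `f`) of a lowest unit ball containing `K` either has the height of
a point of `K`, or lies on a minimal arc between two points of `K`. -/
theorem exists_top_point (hE : Module.finrank ℝ E = 2) {K : Set E} (hK : K.Finite)
    (hd : ∀ p ∈ K, ∀ q ∈ K, ‖p - q‖ ≤ 1) {f : E →L[ℝ] ℝ} (hf : ∀ y, f y ≤ ‖y‖) {t : E}
    (ht : ‖t‖ = 1) (hft : f t = 1) {x : E} (hx : ∀ k ∈ K, ‖k - x‖ ≤ 1)
    (hmin : ∀ x', (∀ k ∈ K, ‖k - x'‖ ≤ 1) → f x ≤ f x') :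
    (∃ k ∈ K, f (k - x) = 1) ∨ ∃ p ∈ K, ∃ q ∈ K, p ≠ q ∧ ‖p - x‖ = 1 ∧ ‖q - x‖ = 1 ∧
      ∃ a b : ℝ, 0 ≤ a ∧ 0 ≤ b ∧ t = a • (p - x) + b • (q - x) := by
  by_contra! hcon
  obtain ⟨h1, h2⟩ := hcon
  obtain ⟨e, g, hgt, hge, hfg⟩ := exists_complementary_coordinate hE hft
  have hf1 (k) (hk : k ∈ K) (_ : ‖k - x‖ = 1) : f (k - x) < 1 :=
    lt_of_le_of_ne ((hf _).trans (hx k hk)) (h1 k hk)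
  -- By the diameter bound `k` itself is an admissible center, so moving towards it is not a
  -- descent.
  have hf0 (k) (hk : k ∈ K) (_ : ‖k - x‖ = 1) : 0 ≤ f (k - x) :=
    not_exists_descent hK hx hmin fun k' hk' _ => by simpa using hd k' hk' k hk
  have hg0 (k) (hk : k ∈ K) (hkx : ‖k - x‖ = 1) : g (k - x) ≠ 0 := by
    intro hg
    have := congrArg norm (hfg (k - x))
    rw [hg, zero_smul, add_zero, hkx, norm_smul, ht, mul_one, Real.norm_of_nonneg (hf0 k hk hkx)] at this
    exact h1 k hk this.symm
  have hpos := not_forall_coordinate_pos hK ht hft hfg hx hmin hf0 hf1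
  have hneg := not_forall_coordinate_pos hK (g := -g) (e := -e) ht hft
    (fun y => by simpa using hfg y) hx hmin hf0 hf1
  push Not at hpos hneg
  obtain ⟨p, hp, hpx, hgp⟩ := hpos
  obtain ⟨q, hq, hqx, hgq⟩ := hneg
  replace hgp : g (p - x) < 0 := lt_of_le_of_ne hgp (hg0 p hp hpx)
  replace hgq : 0 < g (q - x) :=
    lt_of_le_of_ne (by simpa using hgq) (hg0 q hq hqx).symm
  have hpq : p ≠ q := by rintro rfl; exact lt_asymm hgp hgq
  have hfp := hf0 p hp hpx
  have hfq := hf0 q hq hqx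
  have hdpq : ‖(p - x) - (q - x)‖ ≤ 1 := by simpa using hd p hp q hq
  refine (h2 p hp q hq hpq hpx hqx) (g (q - x) / (g (q - x) * f (p - x) - g (p - x) * f (q - x)))
    (-g (p - x) / (g (q - x) * f (p - x) - g (p - x) * f (q - x))) ?_ ?_ ?_
  all_goals
    set u := p - x
    set v := q - x
    -- The coefficients come from Cramer's rule. If the determinant were not positive, `u` and `v`
    -- would be opposite multiples of `e`, at distance `2`.
    have hD : 0 < g v * f u - g u * f v := by
      have hD1 := mul_nonneg hgq.le hfp
      have hD2 := mul_nonneg (neg_nonneg.2 hgp.le) hfq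
      by_contra! hD
      have hfu : f u = 0 := by
        by_contra hne
        have := mul_pos hgq (lt_of_le_of_ne hfp (Ne.symm hne))
        linarith
      have hfv : f v = 0 := by
        by_contra hne
        have := mul_pos (neg_pos.2 hgp) (lt_of_le_of_ne hfq (Ne.symm hne))
        linarith
      have hu := hfg u
      have hv := hfg v
      rw [hfu, zero_smul, zero_add] at hu
      rw [hfv, zero_smul, zero_add] at hv
      have huv : u - v = (g u - g v) • e := by rw [sub_smul, ← hu, ← hv]
      rw [huv, norm_smul, Real.norm_of_nonpos (by linarith)] at hdpq
      rw [hu, norm_smul, Real.norm_of_nonpos hgp.le] at hpx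
      rw [hv, norm_smul, Real.norm_of_nonneg hgq.le] at hqx
      linarith
  · exact div_nonneg hgq.le hD.le
  · exact div_nonneg (by linarith) hD.le
  · have : (g v / (g v * f u - g u * f v)) • (f u • t + g u • e) +
        (-g u / (g v * f u - g u * f v)) • (f v • t + g v • e) = t := by
      match_scalars <;> field_simp <;> ring
    rwa [← hfg, ← hfg, eq_comm] at this

end TopPoint

/-! ### Separation from the convex hull of the arcs. -/

section Hull

variable {E : Type*} [NormedAddCommGroup E] [NormedSpace ℝ E]

theorem isCompact_unit_centers [FiniteDimensional ℝ E] {K : Set E} (hne : K.Nonempty) :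
    IsCompact {x : E | ∀ k ∈ K, ‖k - x‖ ≤ 1} := by
  obtain ⟨k, hk⟩ := hne
  refine (isCompact_closedBall k 1).of_isClosed_subset ?_ fun x hx => ?_
  · simp only [Set.ofPred_forall]
    exact isClosed_biInter fun k _ => isClosed_le (by fun_prop) continuous_const
  · rw [mem_closedBall_iff_norm, norm_sub_rev]; exact hx k hk

theorem isCompact_normArcs [FiniteDimensional ℝ E] {p q : E} (hpq : ‖p - q‖ ≤ 1) (hne : p ≠ q) :
    IsCompact ((fun y : E × ℝ => normArc y.1 p q y.2) ''
      ((Metric.sphere p 1 ∩ Metric.sphere q 1) ×ˢ Set.Icc 0 1)) := by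
  refine IsCompact.image_of_continuousOn
    (((isCompact_sphere p 1).inter_right Metric.isClosed_sphere).prod isCompact_Icc)
    (continuousOn_normArc ?_)
  rintro ⟨x, s⟩ ⟨⟨hp, hq⟩, -⟩
  rw [mem_sphere_iff_norm, norm_sub_rev] at hp hq
  exact normArc_segment_ne_zero
    (linearIndependent_of_norm_sub_le hp hq (by simpa using hpq) (by simpa using hne)) s

/-- A point lying in all unit balls containing `K` is in the convex hull of the minimal arcs. -/
theorem mem_convexHull_minimalArcsUnion (hE : Module.finrank ℝ E = 2) {K : Set E} (hK : K.Finite)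
    (hnt : K.Nontrivial) (hd : ∀ p ∈ K, ∀ q ∈ K, ‖p - q‖ ≤ 1) {z : E}
    (hz : ∀ x, (∀ k ∈ K, ‖k - x‖ ≤ 1) → ‖z - x‖ ≤ 1) :
    z ∈ convexHull ℝ (minimalArcsUnion K) := by
  have : FiniteDimensional ℝ E := Module.finite_of_finrank_pos (by omega)
  -- Radial arcs alone suffice, and they form a compact set, so their hull is closed and strict
  -- separation is available.
  set M : Set E := ⋃ y ∈ K.offDiag, (fun w : E × ℝ => normArc w.1 y.1 y.2 w.2) ''
      ((Metric.sphere y.1 1 ∩ Metric.sphere y.2 1) ×ˢ Set.Icc 0 1) with hMdef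
  have hMc : IsCompact M := hK.offDiag.isCompact_biUnion fun y hy =>
    isCompact_normArcs (hd _ hy.1 _ hy.2.1) hy.2.2
  have hM {p q x w : E} (hp : p ∈ K) (hq : q ∈ K) (hpq : p ≠ q) (hpx : ‖p - x‖ = 1)
      (hqx : ‖q - x‖ = 1) (hw : w ∈ normArc x p q '' Set.Icc 0 1) : w ∈ M := by
    obtain ⟨s, hs, rfl⟩ := hw
    refine Set.mem_biUnion (show (p, q) ∈ K.offDiag from ⟨hp, hq, hpq⟩) ⟨(x, s), ⟨⟨?_, ?_⟩, hs⟩, rfl⟩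
    · rw [mem_sphere_iff_norm, norm_sub_rev]; exact hpx
    · rw [mem_sphere_iff_norm, norm_sub_rev]; exact hqx
  have hMsub : M ⊆ minimalArcsUnion K := by
    simp only [hMdef, Set.iUnion_subset_iff]
    rintro ⟨p, q⟩ ⟨hp, hq, hpq⟩ _ ⟨⟨x, s⟩, ⟨⟨hpx, hqx⟩, hs⟩, rfl⟩
    rw [mem_sphere_iff_norm, norm_sub_rev] at hpx hqx
    exact ⟨p, hp, q, hq, x, _, isMinimalCircularArc_normArc hpx hqx (hd p hp q hq) hpq,
      ⟨s, hs, rfl⟩⟩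
  have hKM : K ⊆ M := by
    intro k hk
    obtain ⟨k', hk', hne⟩ := hnt.exists_ne k
    obtain ⟨x, hx, hx'⟩ := exists_unit_center hE hne.symm (hd k hk k' hk')
    exact hM hk hk' hne.symm hx hx' ⟨0, by simp, normArc_zero hx k'⟩
  refine convexHull_mono hMsub ?_
  by_contra hzM
  obtain ⟨f₀, r, hfr, hrz⟩ := geometric_hahn_banach_closed_point (convex_convexHull ℝ M)
    hMc.convexHull_of_finiteDimensional.isClosed hzM
  have hfM (w) (hw : w ∈ M) : f₀ w < f₀ z := (hfr w (subset_convexHull ℝ M hw)).trans hrz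
  obtain ⟨k₀, hk₀⟩ := hnt.nonempty
  obtain ⟨c, t, hc, ht, hft, hle⟩ := f₀.exists_norm_attaining (by
    rintro rfl; simpa using hfM k₀ (hKM hk₀))
  obtain ⟨x, hx, hmin⟩ := (isCompact_unit_centers hnt.nonempty).exists_isMinOn
    ⟨k₀, fun k hk => hd k hk k₀ hk₀⟩ f₀.continuous.continuousOn
  have hzx : f₀ z ≤ f₀ x + c := by
    have h1 := hle (z - x)
    rw [map_sub] at h1
    nlinarith [hz x hx]
  rcases exists_top_point hE hK hd (f := c⁻¹ • f₀) (t := t) (x := x)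
    (fun y => by
      rw [smul_apply, smul_eq_mul, inv_mul_le_iff₀ hc]; exact hle y) ht
    (by simp [hft, hc.ne']) hx (fun x' hx' => by
      simpa [hc] using (hmin hx' : f₀ x ≤ f₀ x')) with
    ⟨k, hk, hkx⟩ | ⟨p, hp, q, hq, hpq, hpx, hqx, a, b, ha, hb, hab⟩
  · have h1 := hfM k (hKM hk)
    rw [smul_apply, smul_eq_mul, inv_mul_eq_one₀ hc.ne', map_sub] at hkx
    linarith
  · have h1 := hfM (x + t) (hM hp hq hpq hpx hqx (add_mem_image_normArc ha hb ht hab))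
    rw [map_add, hft] at h1
    linarith

end Hull

/-! ### Unit spheres through a fixed point whose balls exclude another point. -/

section Superlevel

variable {E : Type*} [NormedAddCommGroup E] [NormedSpace ℝ E]

/-- Since `|‖y‖ - 1| ≤ 1`, the vector `(w + y) + (a - 1) • ((1 - ‖y‖⁻¹) • y)` has norm at most `a`.
Divided by `a` it is `t + r • y` with `r ≥ 1`, and convexity between `t` and this point gives the
claim. -/
theorem norm_add_le_one_of_cone {t w y : E} {a b : ℝ} (ht : ‖t‖ = 1) (hw : ‖w‖ = 1)
    (hb : 0 ≤ b) (hy2 : ‖y‖ ≤ 2) (hwab : w = a • t + b • y) (ha : 0 ≤ a)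
    (hwy : ‖w + y‖ ≤ 1) : ‖t + y‖ ≤ 1 := by
  rcases eq_or_ne y 0 with rfl | hy
  · simp [ht]
  have hn : 0 < ‖y‖ := norm_pos_iff.2 hy
  have ha1 : 1 ≤ a := by
    have h1 := norm_smul_add_smul_le t (w + y) ha hb
    have e : a • t + b • (w + y) = (1 + b) • w := by rw [hwab]; module
    rw [e, norm_smul_of_nonneg (by linarith), hw, ht] at h1
    nlinarith
  have hab : a ≤ 1 + b * ‖y‖ := by
    have h1 := norm_smul_add_smul_le w (-y) zero_le_one hb
    have e : (1 : ℝ) • w + b • -y = a • t := by rw [hwab]; module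
    rw [e, norm_smul_of_nonneg ha, ht, hw, norm_neg] at h1
    linarith
  have ha0 : 0 < a := by linarith
  have h1 : ‖(w + y) + (a - 1) • ((1 - ‖y‖⁻¹) • y)‖ ≤ a := by
    have e : ‖(1 - ‖y‖⁻¹) • y‖ ≤ 1 := by
      have h2 : 2⁻¹ ≤ ‖y‖⁻¹ := inv_anti₀ hn hy2
      rw [norm_smul, Real.norm_eq_abs, ← le_div_iff₀ hn, one_div, abs_le]
      constructor <;> linarith
    have h2 := norm_add_le (w + y) ((a - 1) • ((1 - ‖y‖⁻¹) • y))
    rw [norm_smul_of_nonneg (sub_nonneg.2 ha1)] at h2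
    nlinarith
  have h2 : ‖t + (1 + (b * ‖y‖ - (a - 1)) / (a * ‖y‖)) • y‖ ≤ 1 := by
    have e : (w + y) + (a - 1) • ((1 - ‖y‖⁻¹) • y) =
        a • (t + (1 + (b * ‖y‖ - (a - 1)) / (a * ‖y‖)) • y) := by
      rw [hwab]; match_scalars <;> field_simp <;> ring
    rw [e, norm_smul_of_nonneg ha] at h1
    exact le_of_mul_le_mul_left (by simpa using h1) ha0
  have := norm_add_smul_le_of_between (b₁ := 0) (b := 1) (by simp [ht]) h2 zero_le_one
    (le_add_of_nonneg_right (div_nonneg (by linarith) (by positivity)))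
  simpa using this

/-- In the main case `0 < ‖y‖ ≤ 2`, the radial arc from `t` to `‖y‖⁻¹ • y` stays in the set by
`norm_add_le_one_of_cone`. For `y = z - k` the set describes the centers `k - t` of unit balls with
`k` on the boundary and `z` outside. -/
theorem isPreconnected_sphere_superlevel (hE : Module.finrank ℝ E = 2) (y : E) :
    IsPreconnected {t : E | ‖t‖ = 1 ∧ 1 < ‖t + y‖} := by
  rcases lt_or_ge 2 ‖y‖ with hy2 | hy2
  · have : {t : E | ‖t‖ = 1 ∧ 1 < ‖t + y‖} = Metric.sphere 0 1 := by
      ext t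
      simp only [Set.mem_ofPred_eq, mem_sphere_zero_iff_norm, and_iff_left_iff_imp]
      intro ht
      have := norm_sub_le (t + y) t
      rw [add_sub_cancel_left] at this
      linarith
    rw [this]
    exact isPreconnected_sphere (one_lt_rank_of_finrank_eq_two hE) 0 1
  rcases eq_or_ne y 0 with rfl | hy
  · convert isPreconnected_empty using 1
    ext t
    simp only [add_zero, Set.mem_ofPred_eq, Set.mem_empty_iff_false, iff_false, not_and, not_lt]
    exact fun h => h.le
  have hn : 0 < ‖y‖ := norm_pos_iff.2 hy
  set v := ‖y‖⁻¹ • y with hv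
  have hv1 : ‖v‖ = 1 := by simp [hv, norm_smul, hy]
  have hyv : y = ‖y‖ • v := by rw [hv, smul_smul, mul_inv_cancel₀ hn.ne', one_smul]
  refine isPreconnected_of_forall v fun t ht => ⟨normArc 0 t v '' Set.Icc 0 1, ?_, ?_, ?_, ?_⟩
  rotate_left
  · exact ⟨1, by simp, normArc_one (by simpa using hv1) t⟩
  · exact ⟨0, by simp, normArc_zero (by simpa using ht.1) v⟩
  all_goals
    have hm (s : ℝ) (hs : s ∈ Set.Icc (0 : ℝ) 1) : (1 - s) • (t - 0) + s • (v - 0) ≠ 0 := by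
      intro h0
      rw [sub_zero, sub_zero] at h0
      have h1 : (1 - s) • t = (-s) • v := by
        rw [neg_smul]; exact eq_neg_of_add_eq_zero_left h0
      have h2 := congrArg norm h1
      rw [norm_smul_of_nonneg (sub_nonneg.2 hs.2), norm_smul, norm_neg, Real.norm_of_nonneg hs.1,
        ht.1, hv1] at h2
      have hs2 : s = 1 / 2 := by linarith
      have htv : t = -v := by
        have : (1 / 2 : ℝ) • t = (1 / 2 : ℝ) • (-v) := by
          rw [hs2] at h1; convert h1 using 1
          · norm_num
          · module
        exact smul_right_injective E (by norm_num : (1 / 2 : ℝ) ≠ 0) this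
      have h3 := ht.2
      have e : t + y = (‖y‖ - 1) • v := by rw [htv]; nth_rw 1 [hyv]; module
      rw [e, norm_smul, hv1, mul_one, Real.norm_eq_abs, lt_abs] at h3
      rcases h3 with h3 | h3 <;> linarith
  · refine isPreconnected_Icc.image _ ?_
    exact (continuousOn_normArc (S := (Set.Icc 0 1).image (Prod.mk 0)) (by
      rintro _ ⟨s, hs, rfl⟩; exact hm s hs)).comp (by fun_prop) fun s hs => ⟨s, hs, rfl⟩
  · rintro _ ⟨s, hs, rfl⟩
    have hw : ‖normArc 0 t v s‖ = 1 := by simpa using norm_normArc_sub (hm s hs)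
    refine ⟨hw, ?_⟩
    by_contra! hle
    refine ht.2.not_ge (norm_add_le_one_of_cone ht.1 hw
      (a := ‖(1 - s) • (t - 0) + s • (v - 0)‖⁻¹ * (1 - s))
      (b := ‖(1 - s) • (t - 0) + s • (v - 0)‖⁻¹ * (s * ‖y‖⁻¹)) ?_ hy2 ?_ ?_ hle)
    · have := hs.1; positivity
    · simp only [normArc, zero_add, sub_zero]
      rw [mul_smul, mul_smul, mul_smul, ← hv, smul_add]
    · have := sub_nonneg.2 hs.2; positivity

/-- Part of the unit sphere is moved out of the unit ball by `y`, but not into its interior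
by `s`. -/
theorem exists_norm_add_gt_and_norm_add_ge (hE : Module.finrank ℝ E = 2) {y s : E} (hy : y ≠ 0)
    (hs : s ≠ 0) : ∃ t, ‖t‖ = 1 ∧ 1 < ‖t + y‖ ∧ 1 ≤ ‖t + s‖ := by
  by_contra! hcon
  have : FiniteDimensional ℝ E := Module.finite_of_finrank_pos (by omega)
  obtain ⟨e, he⟩ := exists_linearIndependent_pair_of_one_lt_finrank
    (show 1 < Module.finrank ℝ E by omega) hs
  -- As `g s = 0`, translation by `s` keeps the line `g = c`, which supports the unit ball. Under
  -- `hcon`, translation by `y` then keeps unit vectors on this line in the ball, and likewise on `g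
  -- = -c`. So `g y = 0`, and all `t + n • y` are unit vectors, which is absurd.
  obtain ⟨-, g, -, -, hgs, hge, -⟩ := exists_plane_coordinates hE he
  obtain ⟨c, t, hc, ht, hgt, hle⟩ := g.exists_norm_attaining (by rintro rfl; simp at hge)
  have hface (w : E) (hw : g w = c) : 1 ≤ ‖w‖ := by
    have := hle w
    rw [hw] at this
    exact le_of_mul_le_mul_left (by simpa using this) hc
  have hmove (w : E) (hw1 : ‖w‖ = 1) (hw : g w = c) : ‖w + y‖ ≤ 1 := by
    by_contra! h
    exact (hcon w hw1 h).not_ge (hface _ (by simp [hw, hgs]))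
  have hmove' (w : E) (hw1 : ‖w‖ = 1) (hw : g w = c) : ‖-w + y‖ ≤ 1 := by
    by_contra! h
    refine (hcon (-w) (by simpa using hw1) h).not_ge ?_
    rw [← norm_neg]
    exact hface _ (by simp [hw, hgs])
  have hgy : g y = 0 := by
    have h1 := hle (t + y)
    have h2 := hle (-(-t + y))
    rw [norm_neg, map_neg, map_add, map_neg, hgt] at h2
    rw [map_add, hgt] at h1
    have := hmove t ht hgt
    have := hmove' t ht hgt
    nlinarith
  have hall (n : ℕ) : ‖t + (n : ℝ) • y‖ = 1 := by
    induction n with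
    | zero => simp [ht]
    | succ n ih =>
      have e : t + ((n + 1 : ℕ) : ℝ) • y = t + (n : ℝ) • y + y := by push_cast; module
      rw [e]
      exact le_antisymm (hmove _ ih (by simp [hgt, hgy])) (hface _ (by simp [hgt, hgy]))
  obtain ⟨n, hn⟩ := exists_nat_gt (2 / ‖y‖)
  have h1 := norm_sub_le (t + (n : ℝ) • y) t
  rw [hall, ht, add_sub_cancel_left, norm_smul_of_nonneg (by positivity)] at h1
  rw [div_lt_iff₀ (norm_pos_iff.2 hy)] at hn
  linarith

end Superlevel

/-! ### Moving an excluding ball until its boundary meets two points of `K`. -/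

section Vertices

variable {E : Type*} [NormedAddCommGroup E] [NormedSpace ℝ E]

/-- A point outside some unit ball containing `K` is outside a unit ball containing `K` whose
boundary meets `K`. -/
theorem exists_unit_center_on_sphere [FiniteDimensional ℝ E] {K : Set E} (hK : K.Finite)
    (hne : K.Nonempty) {z x₀ : E} (hx₀ : ∀ k ∈ K, ‖k - x₀‖ ≤ 1) (hz : 1 < ‖z - x₀‖) :
    ∃ x, (∀ k ∈ K, ‖k - x‖ ≤ 1) ∧ 1 < ‖z - x‖ ∧ ∃ k ∈ K, ‖k - x‖ = 1 := by
  obtain ⟨x, hx, hmax⟩ := (isCompact_unit_centers hne).exists_isMaxOn ⟨x₀, hx₀⟩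
    (f := fun x => ‖z - x‖) (by fun_prop)
  have hzx : 1 < ‖z - x‖ := hz.trans_le (hmax hx₀)
  refine ⟨x, hx, hzx, ?_⟩
  by_contra! hcon
  have hev : ∀ᶠ r in nhdsWithin (0 : ℝ) (Set.Ioi 0), ∀ k ∈ K, ‖k - (x - r • (z - x))‖ ≤ 1 := by
    refine (Filter.eventually_all_finite hK).2 fun k hk => ?_
    have hc : Filter.Tendsto (fun r : ℝ => ‖k - (x - r • (z - x))‖) (nhds 0) (nhds ‖k - x‖) := by
      have : Continuous fun r : ℝ => ‖k - (x - r • (z - x))‖ := by fun_prop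
      simpa using this.tendsto 0
    exact ((hc.eventually (eventually_lt_nhds (lt_of_le_of_ne (hx k hk) (hcon k hk)))).filter_mono
      nhdsWithin_le_nhds).mono fun r hr => hr.le
  obtain ⟨r, hr, hr0⟩ := (hev.and self_mem_nhdsWithin).exists
  have h1 : ‖z - (x - r • (z - x))‖ ≤ ‖z - x‖ := hmax hr
  have e : z - (x - r • (z - x)) = (1 + r) • (z - x) := by module
  have hr0' : 0 < r := hr0
  rw [e, norm_smul_of_nonneg (by linarith)] at h1
  nlinarith

/-- A point outside some unit ball containing `K` is outside a unit ball containing `K` whose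
boundary meets two points of `K`. -/
theorem exists_unit_center_two_points (hE : Module.finrank ℝ E = 2) {K : Set E} (hK : K.Finite)
    (hnt : K.Nontrivial) {z x₀ : E} (hx₀ : ∀ k ∈ K, ‖k - x₀‖ ≤ 1) (hz : 1 < ‖z - x₀‖) :
    ∃ x, (∀ k ∈ K, ‖k - x‖ ≤ 1) ∧ 1 < ‖z - x‖ ∧
      ∃ p ∈ K, ∃ q ∈ K, p ≠ q ∧ ‖p - x‖ = 1 ∧ ‖q - x‖ = 1 := by
  have : FiniteDimensional ℝ E := Module.finite_of_finrank_pos (by omega)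
  by_contra! hcon
  obtain ⟨x, hx, hzx, k, hk, hkx⟩ := exists_unit_center_on_sphere hK hnt.nonempty hx₀ hz
  have hin (x) (hx : ∀ k ∈ K, ‖k - x‖ ≤ 1) (hzx : 1 < ‖z - x‖) (hkx : ‖k - x‖ = 1) (k' : E)
      (hk' : k' ∈ K) (hne : k' ≠ k) : ‖k' - x‖ < 1 :=
    lt_of_le_of_ne (hx k' hk') fun h => hcon x hx hzx k' hk' k hk hne h hkx
  -- Under `hcon`, for each center `k - t` whose ball excludes `z`, the other points of `K` are all
  -- strictly inside or one is strictly outside. Both conditions are open and the first holds at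
  -- `x`, so connectedness gives it throughout.
  have hsub : {t : E | ‖t‖ = 1 ∧ 1 < ‖t + (z - k)‖} ⊆
      {t : E | ∀ k' ∈ K \ {k}, ‖t + (k' - k)‖ < 1} := by
    refine (isPreconnected_sphere_superlevel hE (z - k)).subset_left_of_subset_union
      (v := {t : E | ∃ k' ∈ K \ {k}, 1 < ‖t + (k' - k)‖}) ?_ ?_ ?_ ?_ ?_
    · simp only [Set.ofPred_forall]
      exact (hK.subset Set.sdiff_subset).isOpen_biInter fun k' _ =>
        isOpen_lt (by fun_prop) continuous_const
    · simp only [Set.ofPred_exists, Set.ofPred_and]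
      exact isOpen_iUnion fun k' => isOpen_const.inter
        (isOpen_lt continuous_const (by fun_prop))
    · rw [Set.disjoint_left]
      rintro t ht ⟨k', hk', h⟩
      exact (ht k' hk').not_gt h
    · rintro t ⟨ht1, ht⟩
      by_contra! hnot
      simp only [Set.mem_union, Set.mem_ofPred_eq, not_or, not_exists, not_and, not_lt] at hnot
      refine hnot.1 fun k' hk' => ?_
      have e (k' : E) : k' - (k - t) = t + (k' - k) := by abel
      have := hin (k - t) (fun k₁ hk₁ => ?_) (by rwa [e]) (by simpa using ht1) k' hk'.1 hk'.2
      · rwa [e] at this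
      · rcases eq_or_ne k₁ k with rfl | hne
        · simp [ht1]
        · rw [e]; exact hnot.2 k₁ ⟨hk₁, hne⟩
    · refine ⟨k - x, ⟨hkx, by rwa [add_comm, sub_add_sub_cancel]⟩, fun k' hk' => ?_⟩
      rw [add_comm, sub_add_sub_cancel]
      exact hin x hx hzx hkx k' hk'.1 hk'.2
  obtain ⟨k', hk', hne⟩ := hnt.exists_ne k
  obtain ⟨t, ht1, ht, hts⟩ := exists_norm_add_gt_and_norm_add_ge hE (y := z - k) (s := k' - k)
    (sub_ne_zero.2 (by rintro rfl; exact hzx.ne' hkx)) (sub_ne_zero.2 hne)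
  exact (hsub ⟨ht1, ht⟩ k' ⟨hk', hne⟩).not_ge hts

end Vertices

theorem mainTheorem5 {E : Type*} [NormedAddCommGroup E] [NormedSpace ℝ E]
    (hE : Module.finrank ℝ E = 2) (K : Set E) (hK : K.Finite) (hdiam : Metric.diam K = 1) :
    ballHull K = ⋂₀ {D : Set E | D ∈ unitBallsWithArc K ∧ K ⊆ D} ∧
      ballHull K = convexHull ℝ (minimalArcsUnion K) := by
  have hnt : K.Nontrivial := by
    by_contra h
    rw [Set.not_nontrivial_iff] at h
    rw [Metric.diam_subsingleton h] at hdiam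
    exact zero_ne_one hdiam
  have hd (p) (hp : p ∈ K) (q) (hq : q ∈ K) : ‖p - q‖ ≤ 1 := by
    rw [← dist_eq_norm, ← hdiam]
    exact Metric.dist_le_diam_of_mem hK.isBounded hp hq
  have hsub (x : E) : K ⊆ Metric.closedBall x 1 ↔ ∀ k ∈ K, ‖k - x‖ ≤ 1 := by
    simp only [Set.subset_def, mem_closedBall_iff_norm]
  have hmem (z : E) : z ∈ ballHull K ↔ ∀ x, (∀ k ∈ K, ‖k - x‖ ≤ 1) → ‖z - x‖ ≤ 1 := by
    simp only [ballHull, ballHullRadius, hdiam, Set.mem_iInter, hsub, mem_closedBall_iff_norm]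
  refine ⟨Set.Subset.antisymm ?_ ?_, Set.Subset.antisymm ?_ ?_⟩
  · rintro z hz _ ⟨⟨x, rfl, -⟩, hx⟩
    exact mem_closedBall_iff_norm.2 ((hmem z).1 hz x ((hsub x).1 hx))
  · intro z hz
    rw [hmem]
    intro x₀ hx₀
    by_contra! hlt
    obtain ⟨x, hx, hzx, p, hp, q, hq, hpq, hpx, hqx⟩ :=
      exists_unit_center_two_points hE hK hnt hx₀ hlt
    have := hz _ ⟨⟨x, rfl, p, hp, q, hq, _,
      (isMinimalCircularArc_normArc hpx hqx (hd p hp q hq) hpq).1⟩, (hsub x).2 hx⟩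
    exact hzx.not_ge (mem_closedBall_iff_norm.1 this)
  · intro z hz
    exact mem_convexHull_minimalArcsUnion hE hK hnt hd ((hmem z).1 hz)
  · refine convexHull_min ?_ ?_
    · rintro z ⟨p, hp, q, hq, x, A, hA, hz⟩
      rw [hmem]
      intro y hy
      exact mem_closedBall_iff_norm.1 (hA.subset_closedBall hE (hd p hp q hq)
        (mem_closedBall_iff_norm.2 (hy p hp)) (mem_closedBall_iff_norm.2 (hy q hq)) hz)
    · exact convex_iInter fun x => convex_iInter fun _ => convex_closedBall x _
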